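/- **Theorem 3.16 (Spencer complex).** Let $\Bbbk$ be a commutative unital ring, $A$ an associative unital $\Bbbk$-algebra, and $(\Omega^\bullet_d,\wedge,d)$ an exterior algebra over $A$: a differential graded $\Bbbk$-algebra with $\Omega^0_d=A$, satisfying $d^2=0$ and the graded Leibniz rule, and generated by $A$ and $dA$. Write $\Omega^m_d$ also for the functor $\Omega^m_d\otimes_A-$ on the category ${}_A\mathrm{Mod}$ of left $A$-modules. Let $J^1_dA=(A\otimes_{\Bbbk}A)/N$, where $N=\{\sum_j a_j\otimes b_j : \sum_j a_jb_j=0,\ \sum_j a_j\,db_j=0\}$, with left action on the first factor and right action on the second, and let $J^1_d=J^1_dA\otimes_A-$, with prolongation $j^1_{d,E}(\xi)=[1\otimes1]\otimes_A\xi$. Let $\Omega^1_d\ltimes\Omega^2_d$ be the functor $E\mapsto(\Omega^1_d\oplus\Omega^2_d)\otimes_AE$, where $\Omega^1_d\oplus\Omega^2_d$ has the left action $\lambda(\alpha+\beta)=\lambda\alpha+(d\lambda\wedge\alpha+\lambda\beta)$ and the componentwise right action, and let $\widetilde{\mathfrak D}_E:J^1_dJ^1_dE\to(\Omega^1_d\ltimes\Omega^2_d)E$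 be the $A$-linear map $$[a\otimes b]\otimes_A[c\otimes e]\otimes_A\xi\longmapsto\big(a\,d(bc)\,e+da\wedge d(bc)\,e\big)\otimes_A\xi .$$ The holonomic jet functors $J^n_d:{}_A\mathrm{Mod}\to{}_A\mathrm{Mod}$ are defined by $J^0_d=\mathrm{id}$, $J^1_d$ as above, and, for $n\ge2$, $$J^n_d=\ker\big(\widetilde{\mathfrak D}_{J^{n-2}_d}\circ J^1_d(l^{1,n-2}_d):J^1_dJ^{n-1}_d\to(\Omega^1_d\ltimes\Omega^2_d)J^{n-2}_d\big),$$ with $l^{1,n-1}_d:J^n_d\to J^1_dJ^{n-1}_d$ the inclusion ($l^{1,0}_d=\mathrm{id}$). The prolongations $j^n_d:\mathrm{id}\to J^n_d$ are given by $j^0_d=\mathrm{id}$ and $l^{1,n-1}_d\circ j^n_d=j^1_{d,J^{n-1}_d}\circ j^{n-1}_d$. For $n\ge1$ and $m\ge0$, the Spencer operator $\mathcal S^{n,m}_d:\Omega^m_dJ^n_d\to\Omega^{m+1}_dJ^{n-1}_d$ is the natural transformation $$\omega\otimes_A\xi\longmapsto\sum_j d(\omega y_j)z_j\otimes_A\xi_j,\qquad\text{where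 } l^{1,n-1}_{d,E}(\xi)=\sum_j[y_j\otimes z_j]\otimes_A\xi_j .$$ The $j^n_d$ and $\mathcal S^{n,m}_d$ are natural transformations of functors from ${}_A\mathrm{Mod}$ to the category of $\Bbbk$-modules. Then for every $n\ge0$ the Spencer sequence $$0\to\mathrm{id}\xrightarrow{j^n_d}J^n_d\xrightarrow{\mathcal S^{n,0}_d}\Omega^1_dJ^{n-1}_d\xrightarrow{\mathcal S^{n-1,1}_d}\Omega^2_dJ^{n-2}_d\to\cdots\to\Omega^{n-1}_dJ^1_d\xrightarrow{\mathcal S^{1,n-1}_d}\Omega^n_d\to0$$ is a complex (where $\Omega^0_dJ^n_d$ is identified with $J^n_d$). That is, 1. $\mathcal S^{n,0}_d\circ j^n_d=0$ for all $n\ge1$; 2. $\mathcal S^{n-1,m+1}_d\circ\mathcal S^{n,m}_d=0$ for all $n\ge2$ and $m\ge0$. -/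

import Mathlib

open CategoryTheory TensorProduct MulOpposite

universe u v v₁ w

/-- An exterior algebra `(Ω^•, ∧, d)` over an associative unital `k`-algebra `A`: a differential
graded `k`-algebra `Ω = ⨁ₘ Ω^m` with `Ω^0 = A` (through `ι`), which is generated by `A` and `dA`.
The product of `Ω` is the wedge product. -/
structure ExteriorCalculus (k : Type w) (A : Type u) [CommRing k] [Ring A] [Algebra k A] where
  /-- the underlying algebra -/
  Ω : Type u
  [ring : Ring Ω]
  [algebra : Algebra k Ω]
  /-- the homogeneous components -/
  deg : ℕ → Submodule k Ω
  [gradedMonoid : SetLike.GradedMonoid deg]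
  isInternal : DirectSum.IsInternal deg
  /-- the identification of `A` with the component of degree zero -/
  ι : A →ₐ[k] Ω
  ι_injective : Function.Injective ι
  range_ι : LinearMap.range ι.toLinearMap = deg 0
  /-- the exterior derivative -/
  d : Ω →ₗ[k] Ω
  d_mem : ∀ {m : ℕ} {α : Ω}, α ∈ deg m → d α ∈ deg (m + 1)
  d_d : ∀ α : Ω, d (d α) = 0
  leibniz : ∀ {m : ℕ} {α : Ω}, α ∈ deg m → ∀ β : Ω, d (α * β) = d α * β + (-1) ^ m * (α * d β)
  generated : Algebra.adjoin k (Set.range ι ∪ Set.range fun a => d (ι a)) = ⊤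

attribute [instance] ExteriorCalculus.ring ExteriorCalculus.algebra
  ExteriorCalculus.gradedMonoid

noncomputable section

/-! ### The tensor product `M ⊗_A E` of an `A`-bimodule and a left `A`-module -/

section BalancedTensor

section Objects

variable (A : Type u) [Ring A]
  (M : Type u) [AddCommGroup M] [Module A M] [Module Aᵐᵒᵖ M]
  (E : Type v) [AddCommGroup E] [Module A E]

/-- The relations `m a ⊗ e = m ⊗ a e`. The right action of `A` on `M` is encoded as a left action
of the opposite ring. -/
def balancedRel : Submodule A (M ⊗[ℤ] E) :=
  Submodule.span A {t | ∃ (m : M) (a : A) (e : E), t = (op a • m) ⊗ₜ[ℤ] e - m ⊗ₜ[ℤ] (a • e)}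

/-- `M ⊗_A E`, a left `A`-module through the left action on `M`. -/
def BalancedTensor : Type (max u v) := (M ⊗[ℤ] E) ⧸ balancedRel A M E

instance : AddCommGroup (BalancedTensor A M E) :=
  inferInstanceAs (AddCommGroup ((M ⊗[ℤ] E) ⧸ balancedRel A M E))

instance : Module A (BalancedTensor A M E) :=
  inferInstanceAs (Module A ((M ⊗[ℤ] E) ⧸ balancedRel A M E))

end Objects

namespace BalancedTensor

variable {A : Type u} [Ring A]
  {M : Type u} [AddCommGroup M] [Module A M] [Module Aᵐᵒᵖ M]
  {E : Type v} [AddCommGroup E] [Module A E]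

variable (A M E) in
/-- The quotient map. -/
def mk : M ⊗[ℤ] E →ₗ[A] BalancedTensor A M E := (balancedRel A M E).mkQ

theorem mk_surjective : Function.Surjective (mk A M E) := Submodule.mkQ_surjective _

variable (A) in
/-- The element `m ⊗ e` of `M ⊗_A E`. -/
def tmul (m : M) (e : E) : BalancedTensor A M E := mk A M E (m ⊗ₜ[ℤ] e)

theorem add_tmul (m m' : M) (e : E) : tmul A (m + m') e = tmul A m e + tmul A m' e := by
  rw [tmul, TensorProduct.add_tmul, map_add]; rfl

theorem tmul_add (m : M) (e e' : E) : tmul A m (e + e') = tmul A m e + tmul A m e' := by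
  rw [tmul, TensorProduct.tmul_add, map_add]; rfl

theorem zero_tmul (e : E) : tmul A (0 : M) e = 0 := by
  rw [tmul, TensorProduct.zero_tmul, map_zero]

theorem tmul_zero (m : M) : tmul A m (0 : E) = 0 := by
  rw [tmul, TensorProduct.tmul_zero, map_zero]

theorem smul_tmul (a : A) (m : M) (e : E) : a • tmul A m e = tmul A (a • m) e := rfl

theorem op_smul_tmul (a : A) (m : M) (e : E) : tmul A (op a • m) e = tmul A m (a • e) := by
  rw [← sub_eq_zero, tmul, tmul, ← map_sub]
  exact (Submodule.Quotient.mk_eq_zero _).2 (Submodule.subset_span ⟨m, a, e, rfl⟩)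

theorem induction_on {p : BalancedTensor A M E → Prop} (x : BalancedTensor A M E)
    (zero : p 0) (tmul : ∀ m e, p (tmul A m e)) (add : ∀ x y, p x → p y → p (x + y)) : p x := by
  obtain ⟨t, rfl⟩ := mk_surjective x
  induction t using TensorProduct.induction_on with
  | zero => rw [map_zero]; exact zero
  | tmul m e => exact tmul m e
  | add s t hs ht => rw [map_add]; exact add _ _ hs ht

theorem addHom_ext {P : Type*} [AddCommGroup P] {f g : BalancedTensor A M E →+ P}
    (h : ∀ m e, f (tmul A m e) = g (tmul A m e)) : f = g := by
  ext x
  induction x using induction_on with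
  | zero => simp
  | tmul m e => exact h m e
  | add x y hx hy => rw [map_add, map_add, hx, hy]

section Lift

variable [SMulCommClass A Aᵐᵒᵖ M]

/-- The additive map on `M ⊗_A E` induced by an `A`-balanced biadditive map. -/
def lift {P : Type*} [AddCommGroup P] (f : M →+ E →+ P)
    (hf : ∀ m (a : A) e, f (op a • m) e = f m (a • e)) : BalancedTensor A M E →+ P :=
  QuotientAddGroup.lift (balancedRel A M E).toAddSubgroup
    (TensorProduct.liftAddHom f fun n m e => by simp) (by
      intro t ht
      induction ht using Submodule.closure_induction with
      | zero => exact map_zero _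
      | add x y _ _ hx hy => exact add_mem hx hy
      | smul_mem b x hx =>
        obtain ⟨m, a, e, rfl⟩ := hx
        rw [AddMonoidHom.mem_ker, smul_sub, TensorProduct.smul_tmul', TensorProduct.smul_tmul', map_sub,
          TensorProduct.liftAddHom_tmul, TensorProduct.liftAddHom_tmul, smul_comm, hf, sub_self])

theorem lift_tmul {P : Type*} [AddCommGroup P] (f : M →+ E →+ P)
    (hf : ∀ m (a : A) e, f (op a • m) e = f m (a • e)) (m : M) (e : E) :
    lift f hf (tmul A m e) = f m e := rfl

end Lift

variable (A M) in
/-- `id ⊗ φ : M ⊗_A E → M ⊗_A E'` for a left `A`-linear map `φ`. -/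
def mapRight [SMulCommClass A Aᵐᵒᵖ M] {E' : Type v₁} [AddCommGroup E'] [Module A E']
    (φ : E →ₗ[A] E') : BalancedTensor A M E →ₗ[A] BalancedTensor A M E' :=
  { lift (A := A) (M := M) (E := E) (P := BalancedTensor A M E')
      (AddMonoidHom.mk' (fun m => AddMonoidHom.mk' (fun e => tmul A m (φ e))
        fun e e' => by rw [map_add, tmul_add])
        fun m m' => by ext e; exact add_tmul m m' (φ e))
      (fun m a e => by
        change tmul A (op a • m) (φ e) = tmul A m (φ (a • e))
        rw [op_smul_tmul, map_smul]) with
    map_smul' := fun a x => by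
      change lift _ _ (a • x) = a • lift _ _ x
      induction x using induction_on with
      | zero => simp
      | tmul m e => rfl
      | add x y hx hy => rw [smul_add, map_add, map_add, hx, hy, smul_add] }

theorem mapRight_tmul [SMulCommClass A Aᵐᵒᵖ M] {E' : Type v₁} [AddCommGroup E'] [Module A E']
    (φ : E →ₗ[A] E') (m : M) (e : E) : mapRight A M φ (tmul A m e) = tmul A m (φ e) := rfl

variable (E) in
/-- `f ⊗ id : M ⊗_A E → M' ⊗_A E` for a right `A`-linear map `f`. -/
def mapLeft [SMulCommClass A Aᵐᵒᵖ M]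
    {M' : Type u} [AddCommGroup M'] [Module A M'] [Module Aᵐᵒᵖ M'] :
    (M →ₗ[Aᵐᵒᵖ] M') →+ (BalancedTensor A M E →+ BalancedTensor A M' E) :=
  AddMonoidHom.mk' (fun f =>
    lift (AddMonoidHom.mk' (fun m => AddMonoidHom.mk' (fun e => tmul A (f m) e)
        fun e e' => tmul_add _ _ _)
        fun m m' => by ext e; change tmul A (f (m + m')) e = _; rw [map_add]; exact add_tmul _ _ _)
      (fun m a e => by
        change tmul A (f (op a • m)) e = tmul A (f m) (a • e)
        rw [map_smul, op_smul_tmul]))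
    fun f g => addHom_ext fun m e => add_tmul (f m) (g m) e

theorem mapLeft_tmul [SMulCommClass A Aᵐᵒᵖ M]
    {M' : Type u} [AddCommGroup M'] [Module A M'] [Module Aᵐᵒᵖ M']
    (f : M →ₗ[Aᵐᵒᵖ] M') (m : M) (e : E) : mapLeft E f (tmul A m e) = tmul A (f m) e := rfl

end BalancedTensor

/-- The functor `M ⊗_A - : _A Mod ⥤ _A Mod` given by an `A`-bimodule `M`. -/
def tensorFunctor (A : Type u) [Ring A] (M : Type u) [AddCommGroup M] [Module A M]
    [Module Aᵐᵒᵖ M] [SMulCommClass A Aᵐᵒᵖ M] :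
    ModuleCat.{max u v} A ⥤ ModuleCat.{max u v} A where
  obj E := ModuleCat.of A (BalancedTensor A M E)
  map φ := ModuleCat.ofHom (BalancedTensor.mapRight A M φ.hom)
  map_id E := by
    ext x
    change BalancedTensor.mapRight A M _ x = x
    induction x using BalancedTensor.induction_on with
    | zero => simp
    | tmul m e => rfl
    | add x y hx hy => rw [map_add, hx, hy]
  map_comp φ ψ := by
    ext x
    change BalancedTensor.mapRight A M _ x =
      BalancedTensor.mapRight A M _ (BalancedTensor.mapRight A M _ x)
    induction x using BalancedTensor.induction_on with
    | zero => simp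
    | tmul m e => rfl
    | add x y hx hy => rw [map_add, map_add, map_add, hx, hy]

end BalancedTensor

/-! ### Kernels of natural transformations of endofunctors of `_A Mod` -/

section Kernel

variable {A : Type u} [Ring A] {F G : ModuleCat.{v} A ⥤ ModuleCat.{v} A}

/-- The objectwise kernel of a natural transformation. -/
def kerFunctor (f : F ⟶ G) : ModuleCat.{v} A ⥤ ModuleCat.{v} A where
  obj E := ModuleCat.of A (LinearMap.ker (f.app E).hom)
  map {E E'} φ := ModuleCat.ofHom ((F.map φ).hom.restrict fun x hx => by
    rw [LinearMap.mem_ker] at hx ⊢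
    have h := ConcreteCategory.congr_hom (f.naturality φ) x
    change (f.app E').hom ((F.map φ).hom x) = (G.map φ).hom ((f.app E).hom x) at h
    rw [h, hx, map_zero])
  map_id E := by
    ext x
    change (F.map (𝟙 E)).hom x.1 = x.1
    rw [F.map_id]; rfl
  map_comp φ ψ := by
    ext x
    change (F.map (φ ≫ ψ)).hom x.1 = (F.map ψ).hom ((F.map φ).hom x.1)
    rw [F.map_comp]; rfl

/-- The inclusion of the kernel. -/
def kerInclusion (f : F ⟶ G) : kerFunctor f ⟶ F where
  app E := ModuleCat.ofHom (LinearMap.ker (f.app E).hom).subtype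

end Kernel

namespace ExteriorCalculus

variable {k : Type w} {A : Type u} [CommRing k] [Ring A] [Algebra k A] (X : ExteriorCalculus k A)

/-! ### The bimodules `Ω^m` -/

/-- The space `Ω^m` of `m`-forms. -/
def Form (m : ℕ) : Type u := X.deg m

namespace Form

variable {X} {m : ℕ}

instance : AddCommGroup (X.Form m) := inferInstanceAs (AddCommGroup (X.deg m))

instance : Module k (X.Form m) := inferInstanceAs (Module k (X.deg m))

/-- A form, seen as an element of the exterior algebra. -/
def val (ω : X.Form m) : X.Ω := Subtype.val ω

@[ext] theorem ext {ω η : X.Form m} (h : ω.val = η.val) : ω = η := Subtype.ext h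

theorem val_mem (ω : X.Form m) : ω.val ∈ X.deg m := ω.2

variable (X) in
/-- A homogeneous element of the exterior algebra, seen as a form. -/
def mk (α : X.Ω) (h : α ∈ X.deg m) : X.Form m := ⟨α, h⟩

@[simp] theorem val_mk (α : X.Ω) (h : α ∈ X.deg m) : (mk X α h).val = α := rfl

@[simp] theorem val_zero : (0 : X.Form m).val = 0 := rfl

@[simp] theorem val_add (ω η : X.Form m) : (ω + η).val = ω.val + η.val := rfl

@[simp] theorem val_ksmul (c : k) (ω : X.Form m) : (c • ω).val = c • ω.val := rfl

theorem ι_mem (a : A) : X.ι a ∈ X.deg 0 := by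
  rw [← X.range_ι]; exact ⟨a, rfl⟩

/-- The left action `a ω = a ∧ ω`. -/
instance : SMul A (X.Form m) :=
  ⟨fun a ω => mk X (X.ι a * ω.val) (by
    simpa using SetLike.GradedMul.mul_mem (ι_mem a) ω.val_mem)⟩

/-- The right action `ω a = ω ∧ a`. -/
instance : SMul Aᵐᵒᵖ (X.Form m) :=
  ⟨fun a ω => mk X (ω.val * X.ι a.unop) (by
    simpa using SetLike.GradedMul.mul_mem ω.val_mem (ι_mem a.unop))⟩

@[simp] theorem val_smul (a : A) (ω : X.Form m) : (a • ω).val = X.ι a * ω.val := rfl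

@[simp] theorem val_op_smul (a : Aᵐᵒᵖ) (ω : X.Form m) : (a • ω).val = ω.val * X.ι a.unop := rfl

instance : Module A (X.Form m) where
  one_smul ω := by ext; simp
  mul_smul a b ω := by ext; simp [mul_assoc]
  smul_zero a := by ext; simp
  smul_add a ω η := by ext; simp [mul_add]
  add_smul a b ω := by ext; simp [add_mul]
  zero_smul ω := by ext; simp

instance : Module Aᵐᵒᵖ (X.Form m) where
  one_smul ω := by ext; simp
  mul_smul a b ω := by ext; simp [mul_assoc]
  smul_zero a := by ext; simp
  smul_add a ω η := by ext; simp [add_mul]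
  add_smul a b ω := by ext; simp [mul_add]
  zero_smul ω := by ext; simp

instance : SMulCommClass A Aᵐᵒᵖ (X.Form m) where
  smul_comm a b ω := by ext; simp [mul_assoc]

instance : IsScalarTower k A (X.Form m) where
  smul_assoc c a ω := by ext; simp

end Form

/-- The exterior derivative `d : Ω^m → Ω^{m+1}`. -/
def dForm {m : ℕ} : X.Form m →ₗ[k] X.Form (m + 1) where
  toFun ω := Form.mk X (X.d ω.val) (X.d_mem ω.val_mem)
  map_add' ω η := by ext; simp
  map_smul' c ω := by ext; simp

@[simp] theorem val_dForm {m : ℕ} (ω : X.Form m) : (X.dForm ω).val = X.d ω.val := rfl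

/-- The element `a` of `A`, seen as a form of degree zero. -/
def ofA : A →ₗ[k] X.Form 0 where
  toFun a := Form.mk X (X.ι a) (Form.ι_mem a)
  map_add' a b := by ext; simp
  map_smul' c a := by ext; simp

@[simp] theorem val_ofA (a : A) : (X.ofA a).val = X.ι a := rfl

/-- The derivation `d : A → Ω^1`. -/
def dA : A →ₗ[k] X.Form 1 where
  toFun a := Form.mk X (X.d (X.ι a)) (X.d_mem (Form.ι_mem a))
  map_add' a b := by ext; simp
  map_smul' c a := by ext; simp

@[simp] theorem val_dA (a : A) : (X.dA a).val = X.d (X.ι a) := rfl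

theorem d_ι_mul (a b : A) : X.d (X.ι (a * b)) = X.d (X.ι a) * X.ι b + X.ι a * X.d (X.ι b) := by
  rw [map_mul, X.leibniz (Form.ι_mem a)]; simp

/-! ### The bimodule `J^1 A` -/

/-- The map `A ⊗ A → Ω^1`, `a ⊗ b ↦ a db`. -/
def universalToForm : A ⊗[k] A →ₗ[k] X.Form 1 :=
  TensorProduct.lift (LinearMap.mk₂ k (fun a b => a • X.dA b)
    (fun a a' b => add_smul a a' _) (fun c a b => smul_assoc c a _)
    (fun a b b' => by rw [map_add, smul_add])
    (fun c a b => by ext; simp))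

@[simp] theorem universalToForm_tmul (a b : A) :
    X.universalToForm (a ⊗ₜ[k] b) = a • X.dA b := rfl

theorem mul'_smul (a : A) (t : A ⊗[k] A) :
    LinearMap.mul' k A (a • t) = a * LinearMap.mul' k A t := by
  induction t using TensorProduct.induction_on with
  | zero => simp
  | tmul b c => simp [TensorProduct.smul_tmul', mul_assoc]
  | add s t hs ht => rw [smul_add, map_add, map_add, hs, ht, mul_add]

theorem universalToForm_smul (a : A) (t : A ⊗[k] A) :
    X.universalToForm (a • t) = a • X.universalToForm t := by
  induction t using TensorProduct.induction_on with
  | zero => simp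
  | tmul b c => simp [TensorProduct.smul_tmul', mul_smul]
  | add s t hs ht => rw [smul_add, map_add, map_add, hs, ht, smul_add]

/-- The kernel of the quotient map from the universal one-forms
`Ω_u^1 = {∑ a_j ⊗ b_j | ∑ a_j b_j = 0}` to `Ω^1`, `∑ a_j ⊗ b_j ↦ ∑ a_j db_j`. -/
def jetRel : Submodule A (A ⊗[k] A) where
  carrier := {t | LinearMap.mul' k A t = 0 ∧ X.universalToForm t = 0}
  zero_mem' := by simp
  add_mem' := by
    rintro s t ⟨h1, h2⟩ ⟨h3, h4⟩
    exact ⟨by rw [map_add, h1, h3, add_zero], by rw [map_add, h2, h4, add_zero]⟩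
  smul_mem' := by
    rintro a t ⟨h1, h2⟩
    exact ⟨by rw [mul'_smul, h1, mul_zero], by rw [universalToForm_smul, h2, smul_zero]⟩

/-- `J^1 A`, the quotient of `A ⊗ A` by the kernel of `Ω_u^1 → Ω^1`. Its left action is on the
first factor. -/
def JetAlg : Type u := (A ⊗[k] A) ⧸ X.jetRel

namespace JetAlg

instance : AddCommGroup X.JetAlg := inferInstanceAs (AddCommGroup ((A ⊗[k] A) ⧸ X.jetRel))

instance : Module A X.JetAlg := inferInstanceAs (Module A ((A ⊗[k] A) ⧸ X.jetRel))

/-- The quotient map `A ⊗ A → J^1 A`, written `a ⊗ b ↦ [a ⊗ b]`. -/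
def mk : A ⊗[k] A →ₗ[A] X.JetAlg := X.jetRel.mkQ

theorem mk_surjective : Function.Surjective (mk X) := Submodule.mkQ_surjective _

theorem addHom_ext {P : Type*} [AddCommMonoid P] {f g : X.JetAlg →+ P}
    (h : ∀ a b, f (mk X (a ⊗ₜ b)) = g (mk X (a ⊗ₜ b))) : f = g := by
  ext x
  obtain ⟨t, rfl⟩ := mk_surjective X x
  induction t using TensorProduct.induction_on with
  | zero => simp
  | tmul a b => exact h a b
  | add s t hs ht => rw [map_add, map_add, map_add, hs, ht]

/-- The additive map on `J^1 A` induced by one on `A ⊗ A`. -/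
def lift {P : Type*} [AddCommGroup P] (f : A ⊗[k] A →+ P) (hf : ∀ t ∈ X.jetRel, f t = 0) :
    X.JetAlg →+ P :=
  QuotientAddGroup.lift X.jetRel.toAddSubgroup f hf

@[simp] theorem lift_mk {P : Type*} [AddCommGroup P] (f : A ⊗[k] A →+ P)
    (hf : ∀ t ∈ X.jetRel, f t = 0) (t : A ⊗[k] A) : lift X f hf (mk X t) = f t := rfl

/-- Right multiplication of the second factor of `A ⊗ A`. -/
def rightMul (c : A) : A ⊗[k] A →ₗ[A] A ⊗[k] A :=
  TensorProduct.AlgebraTensorModule.lTensor A A (LinearMap.mulRight k c)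

@[simp] theorem rightMul_tmul (a b c : A) :
    rightMul c (a ⊗ₜ[k] b) = a ⊗ₜ[k] (b * c) := rfl

theorem mul'_rightMul (c : A) (t : A ⊗[k] A) :
    LinearMap.mul' k A (rightMul c t) = LinearMap.mul' k A t * c := by
  induction t using TensorProduct.induction_on with
  | zero => simp
  | tmul a b => simp [mul_assoc]
  | add s t hs ht => rw [map_add, map_add, map_add, hs, ht, add_mul]

theorem universalToForm_rightMul (c : A) (t : A ⊗[k] A) :
    X.universalToForm (rightMul c t) =
      op c • X.universalToForm t + LinearMap.mul' k A t • X.dA c := by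
  induction t using TensorProduct.induction_on with
  | zero => simp
  | tmul a b =>
    ext
    simp only [rightMul_tmul, universalToForm_tmul, Form.val_smul, val_dA, d_ι_mul, Form.val_add,
      Form.val_op_smul, unop_op, LinearMap.mul'_apply, mul_add]
    simp only [map_mul, mul_assoc]
  | add s t hs ht =>
    rw [map_add, map_add, map_add, map_add, hs, ht, smul_add, add_smul]; abel

theorem rightMul_mem (c : A) (t : A ⊗[k] A) (ht : t ∈ X.jetRel) : rightMul c t ∈ X.jetRel := by
  obtain ⟨h1, h2⟩ := ht
  exact ⟨by rw [mul'_rightMul, h1, zero_mul],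
    by rw [universalToForm_rightMul, h1, h2, smul_zero, zero_smul, add_zero]⟩

/-- The right action `[a ⊗ b] c = [a ⊗ b c]`. -/
instance : SMul Aᵐᵒᵖ X.JetAlg :=
  ⟨fun c => X.jetRel.mapQ X.jetRel (rightMul c.unop) (rightMul_mem X c.unop)⟩

theorem op_smul_mk (c : Aᵐᵒᵖ) (t : A ⊗[k] A) : c • mk X t = mk X (rightMul c.unop t) := rfl

theorem op_smul_mk_tmul (c a b : A) :
    op c • mk X (a ⊗ₜ b) = mk X (a ⊗ₜ (b * c)) := rfl

theorem op_smul_add (c : Aᵐᵒᵖ) (x y : X.JetAlg) : c • (x + y) = c • x + c • y :=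
  map_add (X.jetRel.mapQ X.jetRel (rightMul c.unop) (rightMul_mem X c.unop)) x y

theorem induction_on {p : X.JetAlg → Prop} (x : X.JetAlg) (zero : p 0)
    (mk : ∀ a b, p (mk X (a ⊗ₜ b))) (add : ∀ x y, p x → p y → p (x + y)) : p x := by
  obtain ⟨t, rfl⟩ := mk_surjective X x
  induction t using TensorProduct.induction_on with
  | zero => simpa using zero
  | tmul a b => exact mk a b
  | add s t hs ht => rw [map_add]; exact add _ _ hs ht

instance : Module Aᵐᵒᵖ X.JetAlg where
  smul_zero c := map_zero (X.jetRel.mapQ X.jetRel (rightMul c.unop) (rightMul_mem X c.unop))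
  smul_add := op_smul_add X
  one_smul x := by
    obtain ⟨t, rfl⟩ := mk_surjective X x
    rw [op_smul_mk]
    congr 1
    induction t using TensorProduct.induction_on with
    | zero => simp
    | tmul a b => simp
    | add s t hs ht => rw [map_add, hs, ht]
  mul_smul c c' x := by
    obtain ⟨t, rfl⟩ := mk_surjective X x
    simp only [op_smul_mk]
    congr 1
    induction t using TensorProduct.induction_on with
    | zero => simp
    | tmul a b => simp [mul_assoc]
    | add s t hs ht => rw [map_add, map_add, map_add, hs, ht]
  add_smul c c' x := by
    obtain ⟨t, rfl⟩ := mk_surjective X x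
    simp only [op_smul_mk, ← map_add]
    congr 1
    induction t using TensorProduct.induction_on with
    | zero => simp
    | tmul a b => simp [mul_add, TensorProduct.tmul_add]
    | add s t hs ht => rw [map_add, map_add, map_add, hs, ht]; abel
  zero_smul x := by
    obtain ⟨t, rfl⟩ := mk_surjective X x
    rw [op_smul_mk, ← map_zero (mk X)]
    congr 1
    induction t using TensorProduct.induction_on with
    | zero => simp
    | tmul a b => simp
    | add s t hs ht => rw [map_add, hs, ht, add_zero]

instance : SMulCommClass A Aᵐᵒᵖ X.JetAlg where
  smul_comm a c x :=
    (map_smul (X.jetRel.mapQ X.jetRel (rightMul c.unop) (rightMul_mem X c.unop)) a x).symm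

/-- The projection `J^1 A → A`, `[a ⊗ b] ↦ a b`. -/
def proj : X.JetAlg →+ A :=
  lift X (LinearMap.mul' k A).toAddMonoidHom fun _ ht => ht.1

@[simp] theorem proj_mk (t : A ⊗[k] A) : proj X (mk X t) = LinearMap.mul' k A t := rfl

theorem proj_smul (a : A) (x : X.JetAlg) : proj X (a • x) = a * proj X x := by
  obtain ⟨t, rfl⟩ := mk_surjective X x
  rw [← map_smul, proj_mk, proj_mk, mul'_smul]

theorem proj_op_smul (c : Aᵐᵒᵖ) (x : X.JetAlg) : proj X (c • x) = proj X x * c.unop := by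
  obtain ⟨t, rfl⟩ := mk_surjective X x
  rw [op_smul_mk, proj_mk, proj_mk, mul'_rightMul]

/-- The left `A`-linear map `J^1 A → Ω^1`, `[a ⊗ b] ↦ a db`. -/
def leftForm : X.JetAlg →+ X.Form 1 :=
  lift X X.universalToForm.toAddMonoidHom fun _ ht => ht.2

@[simp] theorem leftForm_mk (t : A ⊗[k] A) : leftForm X (mk X t) = X.universalToForm t := rfl

theorem leftForm_smul (a : A) (x : X.JetAlg) : leftForm X (a • x) = a • leftForm X x := by
  obtain ⟨t, rfl⟩ := mk_surjective X x
  rw [← map_smul, leftForm_mk, leftForm_mk, universalToForm_smul]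

theorem leftForm_op_smul (c : A) (x : X.JetAlg) :
    leftForm X (op c • x) = op c • leftForm X x + proj X x • X.dA c := by
  obtain ⟨t, rfl⟩ := mk_surjective X x
  rw [op_smul_mk, leftForm_mk, leftForm_mk, proj_mk, unop_op, universalToForm_rightMul]

end JetAlg

/-! ### The bimodule `Ω^1 ⋉ Ω^2` and the map `D̃` -/

/-- The bimodule `Ω^1 ⋉ Ω^2`: the space `Ω^1 ⊕ Ω^2` with the left action
`a (α + β) = a α + (da ∧ α + a β)` and the componentwise right action. -/
def SemiForm : Type u := X.Form 1 × X.Form 2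

namespace SemiForm

variable {X}

instance : AddCommGroup X.SemiForm := inferInstanceAs (AddCommGroup (X.Form 1 × X.Form 2))

/-- The component of degree one. -/
def one : X.SemiForm →+ X.Form 1 := AddMonoidHom.fst _ _

/-- The component of degree two. -/
def two : X.SemiForm →+ X.Form 2 := AddMonoidHom.snd _ _

variable (X) in
/-- The pair `α + β`. -/
def mk (α : X.Form 1) (β : X.Form 2) : X.SemiForm := (α, β)

@[simp] theorem one_mk (α : X.Form 1) (β : X.Form 2) : (mk X α β).one = α := rfl

@[simp] theorem two_mk (α : X.Form 1) (β : X.Form 2) : (mk X α β).two = β := rfl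

@[ext] theorem ext {x y : X.SemiForm} (h1 : x.one = y.one) (h2 : x.two = y.two) : x = y :=
  Prod.ext h1 h2

/-- The product `Ω^1 × Ω^1 → Ω^2`. -/
def wedge (α β : X.Form 1) : X.Form 2 :=
  Form.mk X (α.val * β.val) (SetLike.GradedMul.mul_mem α.val_mem β.val_mem)

@[simp] theorem val_wedge (α β : X.Form 1) : (wedge α β).val = α.val * β.val := rfl

instance : SMul A X.SemiForm :=
  ⟨fun a x => mk X (a • x.one) (wedge (X.dA a) x.one + a • x.two)⟩

instance : SMul Aᵐᵒᵖ X.SemiForm := ⟨fun a x => mk X (a • x.one) (a • x.two)⟩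

@[simp] theorem one_smul' (a : A) (x : X.SemiForm) : (a • x).one = a • x.one := rfl

@[simp] theorem two_smul' (a : A) (x : X.SemiForm) :
    (a • x).two = wedge (X.dA a) x.one + a • x.two := rfl

@[simp] theorem one_op_smul (a : Aᵐᵒᵖ) (x : X.SemiForm) : (a • x).one = a • x.one := rfl

@[simp] theorem two_op_smul (a : Aᵐᵒᵖ) (x : X.SemiForm) : (a • x).two = a • x.two := rfl

theorem d_ι_one : X.d (X.ι 1) = 0 := by
  have h := X.d_ι_mul 1 1
  rw [mul_one, map_one, mul_one, one_mul] at h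
  rw [map_one]
  simpa using h

instance : Module A X.SemiForm where
  one_smul x := by ext <;> simp [d_ι_one, -map_one]
  mul_smul a b x := by
    ext
    · simp [mul_assoc]
    · simp only [two_smul', one_smul', Form.val_add, val_wedge, val_dA, d_ι_mul, Form.val_smul,
        mul_add, add_mul]
      simp only [map_mul, mul_assoc, add_assoc]
  smul_zero a := by ext <;> simp
  smul_add a x y := by
    ext
    · simp
    · simp [mul_add]; abel
  add_smul a b x := by
    ext
    · simp [add_mul]
    · simp [add_mul]; abel
  zero_smul x := by ext <;> simp

instance : Module Aᵐᵒᵖ X.SemiForm where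
  one_smul x := by ext <;> simp
  mul_smul a b x := by ext <;> simp [mul_assoc]
  smul_zero a := by ext <;> simp
  smul_add a x y := by ext <;> simp [add_mul]
  add_smul a b x := by ext <;> simp [mul_add]
  zero_smul x := by ext <;> simp

instance : SMulCommClass A Aᵐᵒᵖ X.SemiForm where
  smul_comm a b x := by ext <;> simp [mul_assoc, add_mul]

end SemiForm

namespace JetAlg

/-- The right `A`-linear map `J^1 A → Ω^1`, `[a ⊗ b] ↦ (da) b`. -/
def rightForm : X.JetAlg →ₗ[Aᵐᵒᵖ] X.Form 1 where
  toFun x := X.dA (proj X x) - leftForm X x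
  map_add' x y := by simp only [map_add]; abel
  map_smul' c x := by
    induction c using MulOpposite.rec' with | _ c =>
    ext
    simp only [proj_op_smul, leftForm_op_smul, unop_op, RingHom.id_apply]
    simp only [sub_eq_add_neg, Form.val_add, val_dA, d_ι_mul, Form.val_op_smul, add_mul, unop_op]
    have hneg : ∀ η : X.Form 1, (-η).val = -η.val := fun _ => rfl
    simp only [hneg, Form.val_add, Form.val_op_smul, Form.val_smul, val_dA, unop_op, neg_mul]
    abel

@[simp] theorem val_rightForm_mk_tmul (a b : A) :
    (rightForm X (mk X (a ⊗ₜ b))).val = X.d (X.ι a) * X.ι b := by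
  have h : (rightForm X (mk X (a ⊗ₜ b))).val = X.d (X.ι (a * b)) - X.ι a * X.d (X.ι b) := rfl
  rw [h, d_ι_mul]; abel

/-- For `x ∈ J^1 A`, the right `A`-linear map `D̃(x ⊗ -) : J^1 A → Ω^1 ⋉ Ω^2`; on generators
`D̃([a ⊗ b] ⊗ [c ⊗ e]) = a d(b c) e + da ∧ d(b c) e`, see `one_dTildeAlg` and `two_dTildeAlg`. -/
def dTildeAlg : X.JetAlg →+ X.JetAlg →ₗ[Aᵐᵒᵖ] X.SemiForm :=
  AddMonoidHom.mk'
    (fun x =>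
      { toFun := fun y => SemiForm.mk X
          (op (proj X y) • leftForm X x + proj X x • rightForm X y)
          (op (proj X y) • X.dForm (leftForm X x) +
            SemiForm.wedge (rightForm X x) (rightForm X y))
        map_add' := fun y z => by
          ext
          · simp [mul_add]; abel
          · simp [mul_add]; abel
        map_smul' := fun c y => by
          ext <;> simp [proj_op_smul, mul_assoc, add_mul] })
    (fun x y => by
      ext z
      · simp [mul_add, add_mul]; abel
      · simp [mul_add, add_mul]; abel)

theorem dTildeAlg_apply (x y : X.JetAlg) : dTildeAlg X x y = SemiForm.mk X
    (op (proj X y) • leftForm X x + proj X x • rightForm X y)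
    (op (proj X y) • X.dForm (leftForm X x) +
      SemiForm.wedge (rightForm X x) (rightForm X y)) := rfl

theorem one_dTildeAlg (a b c e : A) :
    (dTildeAlg X (mk X (a ⊗ₜ b)) (mk X (c ⊗ₜ e))).one.val =
      X.ι a * X.d (X.ι (b * c)) * X.ι e := by
  rw [dTildeAlg_apply]
  simp only [SemiForm.one_mk, Form.val_add, Form.val_smul, Form.val_op_smul, unop_op, proj_mk,
    leftForm_mk, universalToForm_tmul, LinearMap.mul'_apply, val_dA, val_rightForm_mk_tmul,
    d_ι_mul]
  simp only [map_mul, mul_add, add_mul, mul_assoc]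

theorem two_dTildeAlg (a b c e : A) :
    (dTildeAlg X (mk X (a ⊗ₜ b)) (mk X (c ⊗ₜ e))).two.val =
      X.d (X.ι a) * X.d (X.ι (b * c)) * X.ι e := by
  have h : X.d (X.ι a * X.d (X.ι b)) = X.d (X.ι a) * X.d (X.ι b) := by
    rw [X.leibniz (Form.ι_mem a), X.d_d]; simp
  rw [dTildeAlg_apply]
  simp only [SemiForm.two_mk, Form.val_add, Form.val_smul, Form.val_op_smul, unop_op, proj_mk,
    leftForm_mk, universalToForm_tmul, LinearMap.mul'_apply, val_dA, val_rightForm_mk_tmul,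
    d_ι_mul, val_dForm, SemiForm.val_wedge, h]
  simp only [map_mul, mul_add, add_mul, mul_assoc]

theorem dTildeAlg_op_smul (x y : X.JetAlg) (a : A) :
    dTildeAlg X (op a • x) y = dTildeAlg X x (a • y) := by
  refine DFunLike.congr_fun (f := (dTildeAlg X (op a • x)).toAddMonoidHom)
    (g := (dTildeAlg X x).toAddMonoidHom.comp (DistribSMul.toAddMonoidHom X.JetAlg a)) ?_ y
  refine addHom_ext X fun c e => ?_
  change dTildeAlg X (op a • x) (mk X (c ⊗ₜ e)) = dTildeAlg X x (mk X ((a * c) ⊗ₜ e))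
  induction x using induction_on with
  | zero => rw [smul_zero, map_zero]; rfl
  | add x x' h h' =>
    rw [smul_add, map_add, map_add, LinearMap.add_apply, LinearMap.add_apply, h, h']
  | mk b b' =>
    rw [op_smul_mk_tmul]
    ext
    · rw [one_dTildeAlg, one_dTildeAlg, mul_assoc b' a c]
    · rw [two_dTildeAlg, two_dTildeAlg, mul_assoc b' a c]

theorem dTildeAlg_smul (a : A) (x y : X.JetAlg) :
    dTildeAlg X (a • x) y = a • dTildeAlg X x y := by
  induction x using induction_on with
  | zero => rw [smul_zero, map_zero, LinearMap.zero_apply, smul_zero]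
  | add x x' h h' =>
    rw [smul_add, map_add, map_add, LinearMap.add_apply, LinearMap.add_apply, h, h', smul_add]
  | mk b b' =>
    induction y using induction_on with
    | zero => rw [map_zero, map_zero, smul_zero]
    | add y y' h h' => rw [map_add, map_add, h, h', smul_add]
    | mk c e =>
      have h : a • mk X (b ⊗ₜ b') = mk X ((a * b) ⊗ₜ b') := rfl
      rw [h]
      ext
      · rw [one_dTildeAlg, SemiForm.one_smul', Form.val_smul, one_dTildeAlg]
        simp only [map_mul, mul_assoc]
      · rw [two_dTildeAlg, SemiForm.two_smul', Form.val_add, SemiForm.val_wedge, Form.val_smul,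
          one_dTildeAlg, two_dTildeAlg, d_ι_mul X a b]
        simp only [val_dA, add_mul, mul_assoc]

end JetAlg

section Components

variable (E : Type v) [AddCommGroup E] [Module A E]

/-- `D̃_E : J^1 J^1 E → (Ω^1 ⋉ Ω^2) E`, with
`[a ⊗ b] ⊗ [c ⊗ e] ⊗ ξ ↦ (a d(b c) e + da ∧ d(b c) e) ⊗ ξ`. -/
def dTilde : BalancedTensor A X.JetAlg (BalancedTensor A X.JetAlg E) →ₗ[A]
    BalancedTensor A X.SemiForm E :=
  { BalancedTensor.lift (A := A) ((BalancedTensor.mapLeft E).comp (JetAlg.dTildeAlg X))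
      (fun x a y => by
        induction y using BalancedTensor.induction_on with
        | zero => rw [map_zero, smul_zero, map_zero]
        | add y z hy hz => rw [map_add, hy, hz, smul_add, map_add]
        | tmul y e =>
          rw [BalancedTensor.smul_tmul]
          change BalancedTensor.tmul A (JetAlg.dTildeAlg X (op a • x) y) e =
            BalancedTensor.tmul A (JetAlg.dTildeAlg X x (a • y)) e
          rw [JetAlg.dTildeAlg_op_smul]) with
    map_smul' := fun a x => by
      change BalancedTensor.lift _ _ (a • x) = a • BalancedTensor.lift _ _ x
      induction x using BalancedTensor.induction_on with
      | zero => simp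
      | add x y hx hy => rw [smul_add, map_add, map_add, hx, hy, smul_add]
      | tmul x y =>
        rw [BalancedTensor.smul_tmul, BalancedTensor.lift_tmul, BalancedTensor.lift_tmul]
        induction y using BalancedTensor.induction_on with
        | zero => rw [map_zero, map_zero, smul_zero]
        | add y z hy hz => rw [map_add, map_add, hy, hz, smul_add]
        | tmul y e =>
          change BalancedTensor.tmul A (JetAlg.dTildeAlg X (a • x) y) e =
            BalancedTensor.tmul A (a • JetAlg.dTildeAlg X x y) e
          rw [JetAlg.dTildeAlg_smul] }

theorem dTilde_tmul (x y : X.JetAlg) (e : E) :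
    X.dTilde E (BalancedTensor.tmul A x (BalancedTensor.tmul A y e)) =
      BalancedTensor.tmul A (JetAlg.dTildeAlg X x y) e := rfl

variable {E} in
theorem dTilde_naturality {E' : Type v} [AddCommGroup E'] [Module A E'] (φ : E →ₗ[A] E')
    (x : BalancedTensor A X.JetAlg (BalancedTensor A X.JetAlg E)) :
    X.dTilde E' (BalancedTensor.mapRight A _ (BalancedTensor.mapRight A _ φ) x) =
      BalancedTensor.mapRight A _ φ (X.dTilde E x) := by
  induction x using BalancedTensor.induction_on with
  | zero => simp
  | add x y hx hy => rw [map_add, map_add, map_add, map_add, hx, hy]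
  | tmul x y =>
    rw [BalancedTensor.mapRight_tmul]
    induction y using BalancedTensor.induction_on with
    | zero => simp [BalancedTensor.tmul_zero]
    | add y z hy hz =>
      rw [map_add, BalancedTensor.tmul_add, BalancedTensor.tmul_add, map_add, map_add, map_add,
        hy, hz]
    | tmul y e => rfl

end Components

/-! ### The Spencer operators on `Ω^m J^1` -/

/-- For `ω ∈ Ω^m`, the map `A ⊗ A → Ω^{m+1}`, `y ⊗ z ↦ d(ω y) z`. -/
def spencerUniv {m : ℕ} (ω : X.Form m) : A ⊗[k] A →ₗ[k] X.Form (m + 1) :=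
  TensorProduct.lift (LinearMap.mk₂ k (fun y z => op z • X.dForm (op y • ω))
    (fun y y' z => by rw [MulOpposite.op_add, add_smul, map_add, smul_add])
    (fun c y z => by ext; simp)
    (fun y z z' => by rw [MulOpposite.op_add, add_smul])
    (fun c y z => by ext; simp))

theorem spencerUniv_tmul {m : ℕ} (ω : X.Form m) (y z : A) :
    X.spencerUniv ω (y ⊗ₜ z) = op z • X.dForm (op y • ω) := rfl

theorem val_spencerUniv {m : ℕ} (ω : X.Form m) (t : A ⊗[k] A) :
    (X.spencerUniv ω t).val = X.d ω.val * X.ι (LinearMap.mul' k A t) +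
      (-1) ^ m * (ω.val * (X.d (X.ι (LinearMap.mul' k A t)) - (X.universalToForm t).val)) := by
  induction t using TensorProduct.induction_on with
  | zero => simp
  | add s t hs ht =>
    simp only [map_add, Form.val_add, hs, ht, mul_add, mul_sub]; abel
  | tmul y z =>
    rw [spencerUniv_tmul]
    simp only [Form.val_op_smul, val_dForm, unop_op, X.leibniz ω.val_mem, LinearMap.mul'_apply,
      universalToForm_tmul, Form.val_smul, val_dA, d_ι_mul]
    simp only [map_mul, add_mul, mul_assoc, add_sub_cancel_right]

/-- For `ω ∈ Ω^m`, the map `J^1 A → Ω^{m+1}`, `[y ⊗ z] ↦ d(ω y) z`. -/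
def spencerAlgHom {m : ℕ} (ω : X.Form m) : X.JetAlg →+ X.Form (m + 1) :=
  JetAlg.lift X (X.spencerUniv ω).toAddMonoidHom fun t ht => by
    ext
    change (X.spencerUniv ω t).val = 0
    rw [val_spencerUniv, ht.1, ht.2]; simp

theorem spencerAlgHom_mk_tmul {m : ℕ} (ω : X.Form m) (y z : A) :
    X.spencerAlgHom ω (JetAlg.mk X (y ⊗ₜ z)) = op z • X.dForm (op y • ω) := rfl

/-- The map `[y ⊗ z] ↦ d(ω y) z` as a right `A`-linear map, additive in `ω`. -/
def spencerAlg (m : ℕ) : X.Form m →+ X.JetAlg →ₗ[Aᵐᵒᵖ] X.Form (m + 1) :=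
  AddMonoidHom.mk'
    (fun ω =>
      { toFun := X.spencerAlgHom ω
        map_add' := map_add _
        map_smul' := fun c x => by
          induction c using MulOpposite.rec' with | _ c =>
          induction x using JetAlg.induction_on with
          | zero => simp
          | add x y hx hy => rw [smul_add, map_add, map_add, hx, hy, smul_add]
          | mk y z =>
            rw [JetAlg.op_smul_mk_tmul, spencerAlgHom_mk_tmul, spencerAlgHom_mk_tmul, op_mul,
              mul_smul]; rfl })
    (fun ω η => by
      ext1 x
      change X.spencerAlgHom (ω + η) x = X.spencerAlgHom ω x + X.spencerAlgHom η x
      induction x using JetAlg.induction_on with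
      | zero => simp
      | add x y hx hy => rw [map_add, map_add, map_add, hx, hy]; abel
      | mk y z => simp only [spencerAlgHom_mk_tmul, smul_add, map_add])

theorem spencerAlg_mk_tmul {m : ℕ} (ω : X.Form m) (y z : A) :
    X.spencerAlg m ω (JetAlg.mk X (y ⊗ₜ z)) = op z • X.dForm (op y • ω) := rfl

theorem spencerAlg_op_smul {m : ℕ} (ω : X.Form m) (a : A) (x : X.JetAlg) :
    X.spencerAlg m (op a • ω) x = X.spencerAlg m ω (a • x) := by
  induction x using JetAlg.induction_on with
  | zero => simp
  | add x y hx hy => rw [smul_add, map_add, map_add, hx, hy]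
  | mk y z =>
    have h : a • JetAlg.mk X (y ⊗ₜ z) = JetAlg.mk X ((a * y) ⊗ₜ z) := rfl
    rw [h, spencerAlg_mk_tmul, spencerAlg_mk_tmul, op_mul, mul_smul]

theorem spencerAlg_algebraMap_smul {m : ℕ} (c : k) (ω : X.Form m) (x : X.JetAlg) :
    X.spencerAlg m (algebraMap k A c • ω) x = algebraMap k A c • X.spencerAlg m ω x := by
  induction x using JetAlg.induction_on with
  | zero => simp
  | add x y hx hy => rw [map_add, map_add, hx, hy, smul_add]
  | mk y z =>
    rw [spencerAlg_mk_tmul, spencerAlg_mk_tmul]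
    ext
    simp

section Components

variable (E : Type v) [AddCommGroup E] [Module A E]

/-- The Spencer operator `S^{1,m}_E : Ω^m J^1 E → Ω^{m+1} E`,
`ω ⊗ [y ⊗ z] ⊗ ξ ↦ d(ω y) z ⊗ ξ`. -/
def spencerOneHom (m : ℕ) :
    BalancedTensor A (X.Form m) (BalancedTensor A X.JetAlg E) →+
      BalancedTensor A (X.Form (m + 1)) E :=
  BalancedTensor.lift ((BalancedTensor.mapLeft E).comp (X.spencerAlg m)) fun ω a y => by
    induction y using BalancedTensor.induction_on with
    | zero => rw [map_zero, smul_zero, map_zero]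
    | add y z hy hz => rw [map_add, hy, hz, smul_add, map_add]
    | tmul y e =>
      rw [BalancedTensor.smul_tmul]
      change BalancedTensor.tmul A (X.spencerAlg m (op a • ω) y) e =
        BalancedTensor.tmul A (X.spencerAlg m ω (a • y)) e
      rw [spencerAlg_op_smul]

theorem spencerOneHom_tmul {m : ℕ} (ω : X.Form m) (x : X.JetAlg) (e : E) :
    X.spencerOneHom E m (BalancedTensor.tmul A ω (BalancedTensor.tmul A x e)) =
      BalancedTensor.tmul A (X.spencerAlg m ω x) e := rfl

theorem spencerOneHom_mk_tmul {m : ℕ} (ω : X.Form m) (y z : A) (e : E) :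
    X.spencerOneHom E m (BalancedTensor.tmul A ω
        (BalancedTensor.tmul A (JetAlg.mk X (y ⊗ₜ z)) e)) =
      BalancedTensor.tmul A (op z • X.dForm (op y • ω)) e := rfl

theorem spencerOneHom_algebraMap_smul {m : ℕ} (c : k)
    (x : BalancedTensor A (X.Form m) (BalancedTensor A X.JetAlg E)) :
    X.spencerOneHom E m (algebraMap k A c • x) = algebraMap k A c • X.spencerOneHom E m x := by
  induction x using BalancedTensor.induction_on with
  | zero => simp
  | add x y hx hy => rw [smul_add, map_add, map_add, hx, hy, smul_add]
  | tmul ω y =>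
    rw [BalancedTensor.smul_tmul]
    induction y using BalancedTensor.induction_on with
    | zero => rw [BalancedTensor.tmul_zero, BalancedTensor.tmul_zero, map_zero, smul_zero]
    | add y z hy hz =>
      rw [BalancedTensor.tmul_add, BalancedTensor.tmul_add, map_add, map_add, hy, hz, smul_add]
    | tmul y e =>
      rw [spencerOneHom_tmul, spencerOneHom_tmul, spencerAlg_algebraMap_smul]; rfl

variable {E} in
theorem spencerOneHom_naturality {E' : Type v} [AddCommGroup E'] [Module A E'] (φ : E →ₗ[A] E') {m : ℕ}
    (x : BalancedTensor A (X.Form m) (BalancedTensor A X.JetAlg E)) :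
    X.spencerOneHom E' m (BalancedTensor.mapRight A _ (BalancedTensor.mapRight A _ φ) x) =
      BalancedTensor.mapRight A _ φ (X.spencerOneHom E m x) := by
  induction x using BalancedTensor.induction_on with
  | zero => simp
  | add x y hx hy => rw [map_add, map_add, map_add, map_add, hx, hy]
  | tmul x y =>
    rw [BalancedTensor.mapRight_tmul]
    induction y using BalancedTensor.induction_on with
    | zero => simp [BalancedTensor.tmul_zero]
    | add y z hy hz =>
      rw [map_add, BalancedTensor.tmul_add, BalancedTensor.tmul_add, map_add, map_add, map_add,
        hy, hz]
    | tmul y e => rfl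

theorem tmul_one_algebraMap_smul (c : k) (e : E) :
    BalancedTensor.tmul A (JetAlg.mk X (1 ⊗ₜ 1)) (algebraMap k A c • e) =
      algebraMap k A c • BalancedTensor.tmul A (JetAlg.mk X (1 ⊗ₜ 1)) e := by
  rw [BalancedTensor.smul_tmul, ← BalancedTensor.op_smul_tmul, JetAlg.op_smul_mk_tmul,
    ← map_smul, TensorProduct.smul_tmul', one_mul, smul_eq_mul, mul_one,
    Algebra.algebraMap_eq_smul_one, TensorProduct.tmul_smul, TensorProduct.smul_tmul']

end Components

/-! ### Functors and natural transformations -/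

/-- The forgetful functor `_A Mod ⥤ Mod_k`. -/
abbrev forgetful (k : Type w) (A : Type u) [CommRing k] [Ring A] [Algebra k A] :
    ModuleCat.{max u v} A ⥤ ModuleCat.{max u v} k :=
  ModuleCat.restrictScalars.{max u v} (algebraMap k A)

/-- The functor `Ω^m ⊗_A -`. -/
abbrev formFunctor (m : ℕ) : ModuleCat.{max u v} A ⥤ ModuleCat.{max u v} A :=
  tensorFunctor.{u, v} A (X.Form m)

/-- The 1-jet functor `J^1 = J^1 A ⊗_A -`. -/
abbrev jetOne : ModuleCat.{max u v} A ⥤ ModuleCat.{max u v} A :=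
  tensorFunctor.{u, v} A X.JetAlg

/-- The functor `Ω^1 ⋉ Ω^2`. -/
abbrev semiFunctor : ModuleCat.{max u v} A ⥤ ModuleCat.{max u v} A :=
  tensorFunctor.{u, v} A X.SemiForm

/-- The `A`-linear natural transformation `D̃ : J^1 J^1 ⟶ Ω^1 ⋉ Ω^2`. -/
def dTildeNat : X.jetOne ⋙ X.jetOne ⟶ semiFunctor.{u, v, w} X where
  app E := ModuleCat.ofHom (X.dTilde E)
  naturality E E' φ := by
    ext x
    exact X.dTilde_naturality φ.hom x

/-- The 1-jet prolongation `j^1_E : E → J^1 E`, `ξ ↦ [1 ⊗ 1] ⊗ ξ`, a natural transformation of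
functors `_A Mod ⥤ Mod_k`. -/
def prolongOne : forgetful.{u, v, w} k A ⟶ X.jetOne ⋙ forgetful.{u, v, w} k A where
  app E := ModuleCat.ofHom
    (X := (forgetful.{u, v, w} k A).obj E) (Y := (forgetful.{u, v, w} k A).obj (X.jetOne.obj E))
    { toFun := fun e => BalancedTensor.tmul A (JetAlg.mk X (1 ⊗ₜ 1)) (E := E) e
      map_add' := fun e e' => BalancedTensor.tmul_add (A := A) (E := E) _ e e'
      map_smul' := fun c e => X.tmul_one_algebraMap_smul E c e }
  naturality E E' φ := rfl

/-- The Spencer operators `S^{1,m} : Ω^m J^1 ⟶ Ω^{m+1}`, as natural transformations of functors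
`_A Mod ⥤ Mod_k`. -/
def spencerOne (m : ℕ) : (X.jetOne ⋙ X.formFunctor m) ⋙ forgetful.{u, v, w} k A ⟶
    X.formFunctor (m + 1) ⋙ forgetful.{u, v, w} k A where
  app E := ModuleCat.ofHom
    (X := (forgetful.{u, v, w} k A).obj ((X.formFunctor m).obj (X.jetOne.obj E)))
    (Y := (forgetful.{u, v, w} k A).obj ((X.formFunctor (m + 1)).obj E))
    { X.spencerOneHom E m with
      map_smul' := fun c x => X.spencerOneHom_algebraMap_smul E c x }
  naturality E E' φ := by
    ext x
    exact X.spencerOneHom_naturality φ.hom x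

/-- The canonical natural map `E → Ω^0 ⊗_A E`, `ξ ↦ 1 ⊗ ξ`. -/
def toFormZero : 𝟭 (ModuleCat.{max u v} A) ⟶ formFunctor.{u, v, w} X 0 where
  app E := ModuleCat.ofHom
    { toFun := fun e => BalancedTensor.tmul A (X.ofA 1) e
      map_add' := fun e e' => BalancedTensor.tmul_add _ e e'
      map_smul' := fun a e => by
        rw [← BalancedTensor.op_smul_tmul, RingHom.id_apply, BalancedTensor.smul_tmul]
        congr 1
        ext; simp }
  naturality E E' φ := rfl

/-- The map `E → Ω^0 ⊗_A E`, `ξ ↦ 1 ⊗ ξ`, is bijective. -/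
theorem tmul_ofA_one_bijective (E : Type v) [AddCommGroup E] [Module A E] :
    Function.Bijective fun e : E => BalancedTensor.tmul A (X.ofA 1) e := by
  have hb : Function.Bijective X.ofA := by
    refine ⟨fun a b h => X.ι_injective (congrArg Form.val h), fun ω => ?_⟩
    have h := ω.val_mem
    rw [← X.range_ι] at h
    obtain ⟨a, ha⟩ := h
    exact ⟨a, Form.ext ha⟩
  constructor
  · let r : X.Form 0 ≃+ A := (AddEquiv.ofBijective X.ofA hb).symm
    have hr : ∀ a, r (X.ofA a) = a := fun a => (AddEquiv.ofBijective X.ofA hb).symm_apply_apply a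
    let f : X.Form 0 →+ E →+ E := AddMonoidHom.mk'
      (fun ω => DistribSMul.toAddMonoidHom E (r ω))
      (fun ω η => by ext e; simp [add_smul])
    have hf : ∀ ω (a : A) e, f (op a • ω) e = f ω (a • e) := by
      intro ω a e
      obtain ⟨b, rfl⟩ := hb.2 ω
      have h : op a • X.ofA b = X.ofA (b * a) := by ext; simp
      change r (op a • X.ofA b) • e = r (X.ofA b) • a • e
      rw [h, hr, hr, mul_smul]
    intro e e' h
    have h' := congrArg (BalancedTensor.lift f hf) h
    change r (X.ofA 1) • e = r (X.ofA 1) • e' at h'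
    rwa [hr, one_smul, one_smul] at h'
  · intro x
    induction x using BalancedTensor.induction_on with
    | zero => exact ⟨0, BalancedTensor.tmul_zero _⟩
    | add x y hx hy =>
      obtain ⟨e, rfl⟩ := hx
      obtain ⟨e', rfl⟩ := hy
      exact ⟨e + e', BalancedTensor.tmul_add _ _ _⟩
    | tmul ω e =>
      obtain ⟨a, rfl⟩ := hb.2 ω
      refine ⟨a • e, ?_⟩
      change BalancedTensor.tmul A (X.ofA 1) (a • e) = _
      rw [← BalancedTensor.op_smul_tmul]
      congr 1
      ext; simp

/-! ### The holonomic jet functors -/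

/-- Two consecutive jet functors `P = J^n` and `Q = J^{n+1}`, with the natural transformation
`l = l^{1,n} : J^{n+1} ⟶ J^1 J^n` and the prolongations `j^n`, `j^{n+1}`. -/
structure JetStage where
  P : ModuleCat.{max u v} A ⥤ ModuleCat.{max u v} A
  Q : ModuleCat.{max u v} A ⥤ ModuleCat.{max u v} A
  l : Q ⟶ P ⋙ X.jetOne
  jP : forgetful.{u, v, w} k A ⟶ P ⋙ forgetful.{u, v, w} k A
  jQ : forgetful.{u, v, w} k A ⟶ Q ⋙ forgetful.{u, v, w} k A
  compat : jQ ≫ Functor.whiskerRight l (forgetful k A) = jP ≫ Functor.whiskerLeft P X.prolongOne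

namespace JetStage

variable {X}

/-- The natural transformation `D̃_{J^n} ∘ J^1(l^{1,n}) : J^1 J^{n+1} ⟶ (Ω^1 ⋉ Ω^2) J^n`, whose
kernel is `J^{n+2}`. -/
def holonomy (D : JetStage.{u, v, w} X) : D.Q ⋙ X.jetOne ⟶ D.P ⋙ semiFunctor.{u, v, w} X :=
  Functor.whiskerRight D.l X.jetOne ≫ Functor.whiskerLeft D.P X.dTildeNat

theorem prolong_mem (D : JetStage.{u, v, w} X) (E : ModuleCat.{max u v} A) (e : E) :
    (D.holonomy.app E).hom (BalancedTensor.tmul A (JetAlg.mk X (1 ⊗ₜ 1))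
      (E := D.Q.obj E) ((D.jQ.app E).hom e)) = 0 := by
  have h := ConcreteCategory.congr_hom (NatTrans.congr_app D.compat E) e
  change (D.l.app E).hom ((D.jQ.app E).hom e) =
    BalancedTensor.tmul A (JetAlg.mk X (1 ⊗ₜ 1)) (E := D.P.obj E) ((D.jP.app E).hom e) at h
  change X.dTilde _ (BalancedTensor.tmul A (JetAlg.mk X (1 ⊗ₜ 1)) (E := X.jetOne.obj (D.P.obj E))
    ((D.l.app E).hom ((D.jQ.app E).hom e))) = 0
  rw [h]
  refine (X.dTilde_tmul (D.P.obj E) _ _ _).trans ?_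
  rw [← BalancedTensor.zero_tmul (A := A) (M := X.SemiForm)]
  congr 1
  ext
  · rw [JetAlg.one_dTildeAlg, mul_one, SemiForm.d_ι_one]; simp
  · rw [JetAlg.two_dTildeAlg, mul_one, SemiForm.d_ι_one]; simp

/-- The prolongation `j^{n+2}`, the corestriction of `j^1_{J^{n+1}} ∘ j^{n+1}`. -/
def prolongNext (D : JetStage.{u, v, w} X) :
    forgetful.{u, v, w} k A ⟶ kerFunctor D.holonomy ⋙ forgetful.{u, v, w} k A where
  app E := ModuleCat.ofHom
    (X := (forgetful.{u, v, w} k A).obj E)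
    (Y := (forgetful.{u, v, w} k A).obj ((kerFunctor D.holonomy).obj E))
    { toFun := fun e => (⟨((D.jQ ≫ Functor.whiskerLeft D.Q X.prolongOne).app E).hom e,
        D.prolong_mem E e⟩ : LinearMap.ker (D.holonomy.app E).hom)
      map_add' := fun e e' => Subtype.ext
        (map_add ((D.jQ ≫ Functor.whiskerLeft D.Q X.prolongOne).app E).hom e e')
      map_smul' := fun c e => Subtype.ext
        (map_smul ((D.jQ ≫ Functor.whiskerLeft D.Q X.prolongOne).app E).hom c e) }
  naturality E E' φ := by
    ext e
    exact Subtype.ext (ConcreteCategory.congr_hom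
      ((D.jQ ≫ Functor.whiskerLeft D.Q X.prolongOne).naturality φ) e)

/-- The step from `(J^n, J^{n+1})` to `(J^{n+1}, J^{n+2})`. -/
def next (D : JetStage.{u, v, w} X) : JetStage.{u, v, w} X where
  P := D.Q
  Q := kerFunctor D.holonomy
  l := kerInclusion D.holonomy
  jP := D.jQ
  jQ := D.prolongNext
  compat := rfl

variable (X) in
/-- The stage `(J^0, J^1) = (id, J^1)`, with `l^{1,0} = id` and `j^0 = id`. -/
def zero : JetStage.{u, v, w} X where
  P := 𝟭 _
  Q := X.jetOne
  l := 𝟙 X.jetOne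
  jP := 𝟙 (forgetful k A)
  jQ := X.prolongOne
  compat := rfl

end JetStage

/-- The pair `(J^n, J^{n+1})`. -/
def jetStage : ℕ → JetStage.{u, v, w} X
  | 0 => JetStage.zero X
  | n + 1 => (jetStage n).next

/-- The holonomic `n`-jet functor `J^n`: `J^0 = id`, `J^1 = J^1 A ⊗_A -`, and `J^{n+2}` is the
kernel of `D̃_{J^n} ∘ J^1(l^{1,n}) : J^1 J^{n+1} ⟶ (Ω^1 ⋉ Ω^2) J^n`. -/
def jet (n : ℕ) : ModuleCat.{max u v} A ⥤ ModuleCat.{max u v} A := (jetStage.{u, v, w} X n).P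

/-- The inclusion `l^{1,n} : J^{n+1} ⟶ J^1 J^n`. -/
def jetInclusion (n : ℕ) : jet.{u, v, w} X (n + 1) ⟶ jet.{u, v, w} X n ⋙ X.jetOne :=
  (jetStage X n).l

/-- The `n`-jet prolongation `j^n : id ⟶ J^n`. -/
def prolong (n : ℕ) : forgetful.{u, v, w} k A ⟶ jet.{u, v, w} X n ⋙ forgetful.{u, v, w} k A :=
  (jetStage X n).jP

theorem jet_zero : jet.{u, v, w} X 0 = 𝟭 _ := rfl

theorem jet_one : jet.{u, v, w} X 1 = X.jetOne := rfl

theorem jet_add_two (n : ℕ) : jet.{u, v, w} X (n + 2) =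
    kerFunctor (F := jet.{u, v, w} X (n + 1) ⋙ X.jetOne)
      (G := jet.{u, v, w} X n ⋙ X.semiFunctor)
      (Functor.whiskerRight (X.jetInclusion n) X.jetOne ≫
        Functor.whiskerLeft (jet.{u, v, w} X n) X.dTildeNat) := rfl

theorem prolong_zero : prolong.{u, v, w} X 0 = 𝟙 _ := rfl

theorem prolong_succ (n : ℕ) :
    prolong.{u, v, w} X (n + 1) ≫ Functor.whiskerRight (X.jetInclusion n) (forgetful k A) =
      prolong.{u, v, w} X n ≫ Functor.whiskerLeft (X.jet n) X.prolongOne :=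
  (jetStage X n).compat

/-! ### The Spencer operators and the Spencer sequence -/

/-- The functor `Ω^m J^n`, with values in `Mod_k`. -/
abbrev jetForm (n m : ℕ) : ModuleCat.{max u v} A ⥤ ModuleCat.{max u v} k :=
  (jet.{u, v, w} X n ⋙ X.formFunctor m) ⋙ forgetful.{u, v, w} k A

/-- The holonomic Spencer operator `S^{n+1,m} : Ω^m J^{n+1} ⟶ Ω^{m+1} J^n`: the composite of
`Ω^m(l^{1,n}) : Ω^m J^{n+1} ⟶ Ω^m J^1 J^n` with `S^{1,m}_{J^n}`, that is,
`ω ⊗ (∑_j [y_j ⊗ z_j] ⊗ ξ_j) ↦ ∑_j d(ω y_j) z_j ⊗ ξ_j`. -/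
def spencer (n m : ℕ) : jetForm.{u, v, w} X (n + 1) m ⟶ jetForm.{u, v, w} X n (m + 1) :=
  Functor.whiskerRight (Functor.whiskerRight (X.jetInclusion n) (X.formFunctor m))
      (forgetful k A) ≫
    Functor.whiskerLeft (X.jet n) (X.spencerOne m)

/-- The `n`-jet prolongation `j^n : id ⟶ Ω^0 J^n`, where `J^n` is identified with
`Ω^0 J^n = A ⊗_A J^n`. -/
def prolongForm (n : ℕ) : forgetful.{u, v, w} k A ⟶ jetForm.{u, v, w} X n 0 :=
  X.prolong n ≫ Functor.whiskerRight (Functor.whiskerLeft (X.jet n) X.toFormZero) (forgetful k A)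

/-- The objects of the sequence
`Ω^m J^n ⟶ Ω^{m+1} J^{n-1} ⟶ ⋯ ⟶ Ω^{m+n} J^0 ⟶ 0 ⟶ 0 ⟶ ⋯`; the `i`-th one is
`Ω^{m+i} J^{n-i}` for `i ≤ n`. -/
def spencerTail : (i n m : ℕ) → (ModuleCat.{max u v} A ⥤ ModuleCat.{max u v} k)
  | 0, n, m => jetForm.{u, v, w} X n m
  | _ + 1, 0, _ => (Functor.const _).obj (ModuleCat.of k PUnit)
  | i + 1, n + 1, m => spencerTail i n (m + 1)

/-- The maps of the sequence
`Ω^m J^n ⟶ Ω^{m+1} J^{n-1} ⟶ ⋯ ⟶ Ω^{m+n} J^0 ⟶ 0 ⟶ 0 ⟶ ⋯`. -/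
def spencerTailMap : (i n m : ℕ) →
    (spencerTail.{u, v, w} X i n m ⟶ spencerTail.{u, v, w} X (i + 1) n m)
  | 0, 0, _ => 0
  | 0, n + 1, m => X.spencer n m
  | _ + 1, 0, _ => 0
  | i + 1, n + 1, m => spencerTailMap i n (m + 1)

/-- The objects of the Spencer sequence
`id ⟶ J^n ⟶ Ω^1 J^{n-1} ⟶ ⋯ ⟶ Ω^{n-1} J^1 ⟶ Ω^n ⟶ 0`, continued by zeros. -/
def spencerSeq (n : ℕ) : ℕ → (ModuleCat.{max u v} A ⥤ ModuleCat.{max u v} k)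
  | 0 => forgetful.{u, v, w} k A
  | i + 1 => spencerTail.{u, v, w} X i n 0

/-- The maps of the Spencer sequence: the jet prolongation, followed by the Spencer operators. -/
def spencerSeqMap (n : ℕ) : (i : ℕ) →
    (spencerSeq.{u, v, w} X n i ⟶ spencerSeq.{u, v, w} X n (i + 1))
  | 0 => X.prolongForm n
  | i + 1 => X.spencerTailMap i n 0

end ExteriorCalculus

end

/-!
On generators the graded Leibniz rule and `d² = 0` give, for `ω ∈ Ω^m`,
`d(d(ω a) b c) e = (-1)^{m+1} d(ω a) ∧ d(b c) e`
`                = (-1)^{m+1} dω ∧ (a d(b c) e) - ω ∧ (da ∧ d(b c) e)`,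
so two consecutive Spencer operators on `Ω^m J^1 J^1 E` factor through `D̃_E`. By naturality, the
composite `S^{n+1,m+1} ∘ S^{n+2,m}` then factors through `D̃_{J^n} ∘ J^1(l^{1,n}) ∘ l^{1,n+1}`,
which vanishes because `J^{n+2}` is the kernel of `D̃_{J^n} ∘ J^1(l^{1,n})`. At the left end, the
prolongation has the form `[1 ⊗ 1] ⊗ -`, which the Spencer operator kills since `d1 = 0`.
-/

theorem BalancedTensor.induction_on₂ {A : Type u} [Ring A]
    {M : Type u} [AddCommGroup M] [Module A M] [Module Aᵐᵒᵖ M]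
    {N : Type u} [AddCommGroup N] [Module A N] [Module Aᵐᵒᵖ N]
    {E : Type v} [AddCommGroup E] [Module A E]
    {p : BalancedTensor A M (BalancedTensor A N E) → Prop}
    (x : BalancedTensor A M (BalancedTensor A N E)) (zero : p 0)
    (tmul : ∀ m n e, p (tmul A m (tmul A n e))) (add : ∀ x y, p x → p y → p (x + y)) : p x := by
  induction x using induction_on with
  | zero => exact zero
  | add x y hx hy => exact add x y hx hy
  | tmul m y =>
    induction y using induction_on with
    | zero => rwa [tmul_zero]
    | add y z hy hz => rw [tmul_add]; exact add _ _ hy hz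
    | tmul n e => exact tmul m n e

theorem kerInclusion_comp {A : Type u} [Ring A] {F G : ModuleCat.{v} A ⥤ ModuleCat.{v} A}
    (f : F ⟶ G) : kerInclusion f ≫ f = 0 := by
  ext E x
  exact x.2

namespace ExteriorCalculus

open BalancedTensor

variable {k : Type w} {A : Type u} [CommRing k] [Ring A] [Algebra k A] (X : ExteriorCalculus k A)

section Forms

variable {X} {m n : ℕ}

theorem d_d_mul {α : X.Ω} (hα : α ∈ X.deg m) (β : X.Ω) :
    X.d (X.d α * β) = (-1) ^ (m + 1) * (X.d α * X.d β) := by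
  rw [X.leibniz (X.d_mem hα), X.d_d, zero_mul, zero_add]

/-- The wedge product `Ω^m × Ω^n → Ω^{m+n}`. -/
def Form.wedge (ω : X.Form m) (η : X.Form n) : X.Form (m + n) :=
  Form.mk X (ω.val * η.val) (SetLike.GradedMul.mul_mem ω.val_mem η.val_mem)

theorem Form.val_wedge (ω : X.Form m) (η : X.Form n) : (ω.wedge η).val = ω.val * η.val := rfl

theorem Form.val_sub (ω η : X.Form m) : (ω - η).val = ω.val - η.val := rfl

end Forms

/-- For `ω ∈ Ω^m`, the map `Ω^1 ⋉ Ω^2 → Ω^{m+2}`, `α + β ↦ (-1)^{m+1} dω ∧ α - ω ∧ β`, through which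
`S^{1,m+1} ∘ S^{1,m}` factors. The sign is taken in `k`. -/
def semiWedge {m : ℕ} (ω : X.Form m) : X.SemiForm →ₗ[Aᵐᵒᵖ] X.Form (m + 2) where
  toFun x := (-1 : k) ^ (m + 1) • (X.dForm ω).wedge x.one - ω.wedge x.two
  map_add' x y := by
    ext
    simp only [map_add, Form.val_add, Form.val_sub, Form.val_ksmul, Form.val_wedge, mul_add,
      smul_add]
    abel
  map_smul' c x := by
    ext
    simp [Form.val_sub, Form.val_wedge, mul_assoc, sub_mul]

theorem val_semiWedge {m : ℕ} (ω : X.Form m) (x : X.SemiForm) :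
    (X.semiWedge ω x).val =
      (-1) ^ (m + 1) * (X.d ω.val * x.one.val) - ω.val * x.two.val := by
  change (-1 : k) ^ (m + 1) • (X.d ω.val * x.one.val) - ω.val * x.two.val = _
  rw [Algebra.smul_def, map_pow, map_neg, map_one]

theorem val_spencerAlg_mk_tmul {m : ℕ} (ω : X.Form m) (y z : A) :
    (X.spencerAlg m ω (JetAlg.mk X (y ⊗ₜ z))).val = X.d (ω.val * X.ι y) * X.ι z := rfl

theorem spencerAlg_spencerAlg_mk_tmul {m : ℕ} (ω : X.Form m) (a b c e : A) :
    X.spencerAlg (m + 1) (X.spencerAlg m ω (JetAlg.mk X (a ⊗ₜ b))) (JetAlg.mk X (c ⊗ₜ e)) =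
      X.semiWedge ω (JetAlg.dTildeAlg X (JetAlg.mk X (a ⊗ₜ b)) (JetAlg.mk X (c ⊗ₜ e))) := by
  have hωa : ω.val * X.ι a ∈ X.deg m := (op a • ω).val_mem
  have hsign : (-1 : X.Ω) ^ (m + 1) * (-1) ^ m = -1 := by
    rw [pow_succ', mul_assoc, ← pow_add, Even.neg_one_pow ⟨m, rfl⟩, mul_one]
  ext
  rw [val_spencerAlg_mk_tmul, val_spencerAlg_mk_tmul, val_semiWedge, JetAlg.one_dTildeAlg,
    JetAlg.two_dTildeAlg]
  calc X.d (X.d (ω.val * X.ι a) * X.ι b * X.ι c) * X.ι e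
    _ = (-1) ^ (m + 1) * (X.d (ω.val * X.ι a) * X.d (X.ι (b * c))) * X.ι e := by
      rw [mul_assoc (X.d _), ← map_mul, d_d_mul hωa]
    _ = (-1) ^ (m + 1) * (X.d ω.val * (X.ι a * X.d (X.ι (b * c)) * X.ι e)) +
        (-1) ^ (m + 1) * (-1) ^ m * (ω.val * (X.d (X.ι a) * X.d (X.ι (b * c)) * X.ι e)) := by
      rw [X.leibniz ω.val_mem]
      simp only [add_mul, mul_add, mul_assoc]
    _ = (-1) ^ (m + 1) * (X.d ω.val * (X.ι a * X.d (X.ι (b * c)) * X.ι e)) -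
        ω.val * (X.d (X.ι a) * X.d (X.ι (b * c)) * X.ι e) := by
      rw [hsign, neg_one_mul, sub_eq_add_neg]

theorem spencerAlg_spencerAlg {m : ℕ} (ω : X.Form m) (x y : X.JetAlg) :
    X.spencerAlg (m + 1) (X.spencerAlg m ω x) y = X.semiWedge ω (JetAlg.dTildeAlg X x y) := by
  induction x using JetAlg.induction_on with
  | zero => simp only [map_zero, LinearMap.zero_apply]
  | add x x' hx hx' => simp only [map_add, LinearMap.add_apply, hx, hx']
  | mk a b =>
    induction y using JetAlg.induction_on with
    | zero => simp only [map_zero]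
    | add y y' hy hy' => simp only [map_add, hy, hy']
    | mk c e => exact X.spencerAlg_spencerAlg_mk_tmul ω a b c e

theorem spencerOneHom_spencerOneHom (E : Type v) [AddCommGroup E] [Module A E] {m : ℕ}
    (ω : X.Form m) (t : BalancedTensor A X.JetAlg (BalancedTensor A X.JetAlg E)) :
    X.spencerOneHom E (m + 1) (X.spencerOneHom _ m (tmul A ω t)) =
      mapLeft E (X.semiWedge ω) (X.dTilde E t) := by
  induction t using BalancedTensor.induction_on₂ with
  | zero => simp only [BalancedTensor.tmul_zero, map_zero]
  | add s t hs ht => simp only [BalancedTensor.tmul_add, map_add, hs, ht]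
  | tmul x y e =>
    rw [spencerOneHom_tmul, spencerOneHom_tmul, dTilde_tmul, mapLeft_tmul, spencerAlg_spencerAlg]

theorem spencerOneHom_comp_eq_zero {E : Type v} [AddCommGroup E] [Module A E]
    {F : Type (max u v)} [AddCommGroup F] [Module A F] {G : Type v₁} [AddCommGroup G] [Module A G]
    (l : F →ₗ[A] BalancedTensor A X.JetAlg E) (l' : G →ₗ[A] BalancedTensor A X.JetAlg F)
    (h : ∀ x, X.dTilde E (mapRight A X.JetAlg l (l' x)) = 0) {m : ℕ}
    (t : BalancedTensor A (X.Form m) G) :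
    X.spencerOneHom E (m + 1) (mapRight A _ l (X.spencerOneHom F m (mapRight A _ l' t))) = 0 := by
  induction t using BalancedTensor.induction_on with
  | zero => simp only [map_zero]
  | add s t hs ht => simp only [map_add, hs, ht, add_zero]
  | tmul ω x =>
    rw [mapRight_tmul, ← spencerOneHom_naturality.{u, max u v, w}, mapRight_tmul,
      spencerOneHom_spencerOneHom, h, map_zero]

theorem jetInclusion_succ_comp_dTildeNat (n : ℕ) :
    jetInclusion.{u, v, w} X (n + 1) ≫ Functor.whiskerRight (X.jetInclusion n) X.jetOne ≫
      Functor.whiskerLeft (X.jet n) X.dTildeNat = 0 :=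
  kerInclusion_comp _

theorem spencer_comp_spencer (n m : ℕ) :
    spencer.{u, v, w} X (n + 1) m ≫ spencer.{u, v, w} X n (m + 1) = 0 := by
  ext E t
  exact X.spencerOneHom_comp_eq_zero ((X.jetInclusion n).app E).hom
    ((X.jetInclusion (n + 1)).app E).hom
    (ConcreteCategory.congr_hom (NatTrans.congr_app (X.jetInclusion_succ_comp_dTildeNat n) E)) t

theorem spencerOneHom_ofA_one_tmul_mk_one (E : Type v) [AddCommGroup E] [Module A E] (e : E) :
    X.spencerOneHom E 0 (tmul A (X.ofA 1) (tmul A (JetAlg.mk X (1 ⊗ₜ 1)) e)) = 0 := by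
  have d_one : X.dForm (X.ofA 1) = 0 := Form.ext SemiForm.d_ι_one
  rw [spencerOneHom_mk_tmul, op_one, one_smul, one_smul, d_one, BalancedTensor.zero_tmul]

theorem prolongForm_comp_spencer (n : ℕ) :
    prolongForm.{u, v, w} X (n + 1) ≫ spencer.{u, v, w} X n 0 = 0 := by
  ext E e
  have hj : ((X.jetInclusion n).app E).hom (((X.prolong (n + 1)).app E).hom e) =
      tmul A (JetAlg.mk X (1 ⊗ₜ 1)) (E := (jet.{u, v, w} X n).obj E)
        (((X.prolong n).app E).hom e) :=
    ConcreteCategory.congr_hom (NatTrans.congr_app (X.prolong_succ n) E) e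
  change X.spencerOneHom ((jet.{u, v, w} X n).obj E) 0
    (tmul A (X.ofA 1) (((X.jetInclusion n).app E).hom (((X.prolong (n + 1)).app E).hom e))) = 0
  rw [hj]
  exact X.spencerOneHom_ofA_one_tmul_mk_one _ _

theorem spencerTailMap_comp : ∀ i n m : ℕ,
    spencerTailMap.{u, v, w} X i n m ≫ spencerTailMap.{u, v, w} X (i + 1) n m = 0
  | 0, 0, _ => Limits.zero_comp
  | 0, 1, _ => Limits.comp_zero
  | 0, n + 2, m => X.spencer_comp_spencer n m
  | _ + 1, 0, _ => Limits.zero_comp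
  | i + 1, n + 1, m => spencerTailMap_comp i n (m + 1)

theorem spencerSeqMap_comp : ∀ n i : ℕ,
    spencerSeqMap.{u, v, w} X n i ≫ spencerSeqMap.{u, v, w} X n (i + 1) = 0
  | 0, 0 => Limits.comp_zero
  | n + 1, 0 => X.prolongForm_comp_spencer n
  | n, i + 1 => X.spencerTailMap_comp i n 0

end ExteriorCalculus

theorem theorem3p16 {k : Type w} {A : Type u} [CommRing k] [Ring A] [Algebra k A]
    (X : ExteriorCalculus k A) :
    -- the Spencer sequence is a complex, for every `n`
    (∀ n i : ℕ, ExteriorCalculus.spencerSeqMap.{u, v, w} X n i ≫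
      ExteriorCalculus.spencerSeqMap.{u, v, w} X n (i + 1) = 0) ∧
    -- `S^{n+1,0} ∘ j^{n+1} = 0`
    (∀ n : ℕ, ExteriorCalculus.prolongForm.{u, v, w} X (n + 1) ≫
      ExteriorCalculus.spencer.{u, v, w} X n 0 = 0) ∧
    -- `S^{n+1,m+1} ∘ S^{n+2,m} = 0`
    (∀ n m : ℕ, ExteriorCalculus.spencer.{u, v, w} X (n + 1) m ≫
      ExteriorCalculus.spencer.{u, v, w} X n (m + 1) = 0) :=
  ⟨X.spencerSeqMap_comp, X.prolongForm_comp_spencer, X.spencer_comp_spencer⟩
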